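/- Let $X$ be a real or complex Banach space with the approximation property: for every compact $K\subset X$ and $\varepsilon>0$ there is a bounded finite-rank operator $A$ on $X$ with $\|Ax-x\|<\varepsilon$ for all $x\in K$. A bounded operator $T$ on $X$ is called nuclear if $T=\sum_{k} f_k\otimes x_k$ with $f_k\in X^*$, $x_k\in X$, $\sum_k\|f_k\|\,\|x_k\|<\infty$, where $(f\otimes x)(y)=f(y)x$; its trace is $\operatorname{tr}T=\sum_k f_k(x_k)$, which does not depend on the representation. **Theorem.** Let $P,Q$ be bounded projections on $X$ ($P^2=P$, $Q^2=Q$), and let $n$ be an odd positive integer such that $(P-Q)^n$ is nuclear. For scalars $a,b$ put $$E_{ab}=\{x\in X: Px=ax,\ Qx=bx\},\qquad \tilde E_{ab}=\{x^*\in X^*: P^*x^*=ax^*,\ Q^*x^*=bx^*\}.$$ Then $E_{10},E_{01},\tilde E_{10},\tilde E_{01}$ are finite-dimensional and $$\operatorname{tr}(P-Q)^n=\dim E_{10}-\dim\tilde E_{01}=\dim\tilde E_{10}-\dim E_{01};$$ in particular $\operatorname{tr}(P-Q)^n$ is an integer. Moreover, if $H$ is a real or complex Hilbert space, $P,Q$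 are self-adjoint projections on $H$ and $(P-Q)^n$ is nuclear (i.e. trace class) for some odd positive integer $n$, then $E_{10}$ and $E_{01}$ are finite-dimensional and $$\operatorname{tr}(P-Q)^n=\dim E_{10}-\dim E_{01}.$$ -/

import Mathlib

noncomputable section

namespace ProjectionTrace

/-- The (Grothendieck) approximation property of a normed space: the identity can be approximated,
uniformly on every compact set, by bounded operators of finite rank. -/
def ApproximationProperty (𝕜 X : Type*) [RCLike 𝕜] [NormedAddCommGroup X] [NormedSpace 𝕜 X] :
    Prop :=
  ∀ K : Set X, IsCompact K → ∀ ε : ℝ, 0 < ε →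
    ∃ A : X →L[𝕜] X, FiniteDimensional 𝕜 (LinearMap.range (A : X →ₗ[𝕜] X)) ∧
      ∀ x ∈ K, ‖A x - x‖ < ε

section Defs

variable {𝕜 X : Type*} [RCLike 𝕜] [NormedAddCommGroup X] [NormedSpace 𝕜 X]

/-- `f`, `x` form a nuclear representation of `T`: the rank-one operators
`f k ⊗ x k : y ↦ f k y • x k`, whose operator norms are `‖f k‖ * ‖x k‖`, form an absolutely
convergent series with sum `T` (in operator norm). Zero terms are allowed. -/
def IsNuclearRep (T : X →L[𝕜] X) (f : ℕ → StrongDual 𝕜 X) (x : ℕ → X) : Prop :=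
  Summable (fun k => ‖f k‖ * ‖x k‖) ∧ HasSum (fun k => (f k).smulRight (x k)) T

/-- Nuclear operators. -/
def IsNuclear (T : X →L[𝕜] X) : Prop :=
  ∃ (f : ℕ → StrongDual 𝕜 X) (x : ℕ → X), IsNuclearRep T f x

/-- `T` is nuclear, its trace is unambiguously defined, and `tr T = c`: for every nuclear
representation `T = ∑ f k ⊗ x k`, the series `∑ f k (x k)` of the traces of the rank-one terms
has sum `c`. -/
def HasNuclearTrace (T : X →L[𝕜] X) (c : 𝕜) : Prop :=
  IsNuclear T ∧
    ∀ (f : ℕ → StrongDual 𝕜 X) (x : ℕ → X), IsNuclearRep T f x → HasSum (fun k => f k (x k)) c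

/-- The Banach space adjoint `T* : X* → X*`, `T* φ = φ ∘ T`. -/
def dualOp (T : X →L[𝕜] X) : StrongDual 𝕜 X →L[𝕜] StrongDual 𝕜 X :=
  ContinuousLinearMap.precomp 𝕜 T

theorem dualOp_apply (T : X →L[𝕜] X) (φ : StrongDual 𝕜 X) (x : X) : dualOp T φ x = φ (T x) := rfl

/-- The subspace `E_{ab} = {x : P x = a x, Q x = b x}`. -/
def jointEigenspace (P Q : X →L[𝕜] X) (a b : 𝕜) : Submodule 𝕜 X where
  carrier := {x | P x = a • x ∧ Q x = b • x}
  zero_mem' := by simp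
  add_mem' := by
    rintro x y ⟨hx, hx'⟩ ⟨hy, hy'⟩
    exact ⟨by rw [map_add, hx, hy, smul_add], by rw [map_add, hx', hy', smul_add]⟩
  smul_mem' := by
    rintro c x ⟨hx, hx'⟩
    exact ⟨by rw [map_smul, hx, smul_comm], by rw [map_smul, hx', smul_comm]⟩

end Defs

end ProjectionTrace

end

/-!
Write `A = P - Q` and `B = 1 - P - Q`. For idempotents `P`, `Q` one has `A² + B² = 1` and
`A B = -B A`, and `A²` commutes with `P` and `Q`. Since `A ^ n` is nuclear, `A ^ (2n)` is compact,
and Riesz theory (`exists_riesz_decomposition`) for `L = 1 - A ^ (2n)` gives a finite-rank projection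
`R`, commuting with `P` and `Q`, such that `L` is invertible on the range of `1 - R`. The trace of
`A ^ n` is computed separately on the two summands.

* On the range of `1 - R`, the operator `B` is invertible because `B²` divides `L`, and it
  conjugates `A ^ n` into `-A ^ n` as `n` is odd; hence that part has trace zero
  (`hasTraceRep_sub_pow_mul_compl`). This argument replaces a sum over eigenvalues, which is not
  available: nuclear operators on Banach spaces may violate Lidskii's formula.
* On the finite-dimensional range of `R`, the same anticommutation gives `tr A ^ n = tr A`
  (`trace_sub_pow_of_odd`), which is `rank P - rank Q`, and by dimension counting this equals
  `dim (range P ⊓ ker Q) - codim (range P ⊔ ker Q)` (`trace_sub_eq_finrank_sub_finrank`). The two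
  terms are the dimensions of `E₁₀` and of `Ẽ₀₁`: eigenvectors for the eigenvalues `±1` of `A` and
  of its dual live on the range of `R`.

The second formula is the first one for the pair `Q`, `P`. The approximation property enters only
through the uniqueness of the trace (`HasTraceRep.eq_of_rep`). A Hilbert space has it, and there the
Riesz isomorphism identifies `Ẽ₀₁` with `E₀₁`.
-/

noncomputable section

namespace ProjectionTrace

open Filter Topology

/-! ### Nuclear representations and their traces -/

section Trace

variable {𝕜 X : Type*} [RCLike 𝕜] [NormedAddCommGroup X] [NormedSpace 𝕜 X]

/-- Some nuclear representation `T = ∑ f k ⊗ x k` has trace `∑ f k (x k) = c`. Unlike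
`HasNuclearTrace`, this does not claim that `c` is independent of the representation. -/
def HasTraceRep (T : X →L[𝕜] X) (c : 𝕜) : Prop :=
  ∃ (f : ℕ → StrongDual 𝕜 X) (x : ℕ → X), IsNuclearRep T f x ∧ HasSum (fun k => f k (x k)) c

theorem IsNuclearRep.summable_apply {T : X →L[𝕜] X} {f : ℕ → StrongDual 𝕜 X} {x : ℕ → X}
    (h : IsNuclearRep T f x) : Summable (fun k => f k (x k)) :=
  Summable.of_norm_bounded h.1 fun k => (f k).le_opNorm (x k)

theorem HasTraceRep.add {S T : X →L[𝕜] X} {c d : 𝕜} (hS : HasTraceRep S c)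
    (hT : HasTraceRep T d) : HasTraceRep (S + T) (c + d) := by
  obtain ⟨f, x, ⟨h1, h2⟩, h3⟩ := hS
  obtain ⟨g, y, ⟨k1, k2⟩, k3⟩ := hT
  obtain ⟨e⟩ : Nonempty (ℕ ≃ ℕ ⊕ ℕ) := ⟨Equiv.natSumNatEquivNat.symm⟩
  have s1 : HasSum (fun s => ‖Sum.elim f g s‖ * ‖Sum.elim x y s‖) _ :=
    HasSum.sum (f := fun s => ‖Sum.elim f g s‖ * ‖Sum.elim x y s‖) h1.hasSum k1.hasSum
  have s2 : HasSum (fun s => (Sum.elim f g s).smulRight (Sum.elim x y s)) (S + T) :=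
    HasSum.sum (f := fun s => (Sum.elim f g s).smulRight (Sum.elim x y s)) h2 k2
  have s3 : HasSum (fun s => Sum.elim f g s (Sum.elim x y s)) (c + d) :=
    HasSum.sum (f := fun s => Sum.elim f g s (Sum.elim x y s)) h3 k3
  exact ⟨fun k => Sum.elim f g (e k), fun k => Sum.elim x y (e k),
    ⟨(e.hasSum_iff.2 s1).summable, e.hasSum_iff.2 s2⟩, e.hasSum_iff.2 s3⟩

theorem hasTraceRep_smulRight (f : StrongDual 𝕜 X) (x : X) :
    HasTraceRep (f.smulRight x) (f x) := by
  refine ⟨Pi.single 0 f, Pi.single 0 x, ⟨?_, ?_⟩, ?_⟩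
  · refine summable_of_ne_finset_zero (s := {0}) fun k hk => ?_
    rw [Finset.mem_singleton] at hk
    simp [hk]
  · convert hasSum_single (f := fun k => ContinuousLinearMap.smulRight
      ((Pi.single 0 f : ℕ → StrongDual 𝕜 X) k) ((Pi.single 0 x : ℕ → X) k)) 0 ?_ using 1
    · simp
    · intro k hk
      ext y
      simp [hk]
  · convert hasSum_single (f := fun k =>
      ((Pi.single 0 f : ℕ → StrongDual 𝕜 X) k) ((Pi.single 0 x : ℕ → X) k)) 0 ?_ using 1
    · simp
    · intro k hk
      simp [hk]

theorem hasTraceRep_zero : HasTraceRep (0 : X →L[𝕜] X) 0 := by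
  have := hasTraceRep_smulRight (0 : StrongDual 𝕜 X) (0 : X)
  have h0 : (0 : StrongDual 𝕜 X).smulRight (0 : X) = 0 := by ext; simp
  rwa [h0, map_zero] at this

theorem hasTraceRep_sum {ι : Type*} (s : Finset ι) (T : ι → X →L[𝕜] X) (c : ι → 𝕜)
    (h : ∀ i ∈ s, HasTraceRep (T i) (c i)) : HasTraceRep (∑ i ∈ s, T i) (∑ i ∈ s, c i) := by
  classical
  induction s using Finset.induction_on with
  | empty => simpa using hasTraceRep_zero
  | insert a s ha ih =>
    rw [Finset.sum_insert ha, Finset.sum_insert ha]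
    exact (h a (Finset.mem_insert_self a s)).add
      (ih fun i hi => h i (Finset.mem_insert_of_mem hi))

theorem IsNuclearRep.mul_left {T : X →L[𝕜] X} {f : ℕ → StrongDual 𝕜 X} {x : ℕ → X}
    (h : IsNuclearRep T f x) (S : X →L[𝕜] X) : IsNuclearRep (S * T) f (fun k => S (x k)) := by
  refine ⟨?_, ?_⟩
  · refine Summable.of_nonneg_of_le (fun k => by positivity) (fun k => ?_) (h.1.mul_left ‖S‖)
    calc ‖f k‖ * ‖S (x k)‖ ≤ ‖f k‖ * (‖S‖ * ‖x k‖) := by gcongr; exact S.le_opNorm _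
      _ = ‖S‖ * (‖f k‖ * ‖x k‖) := by ring
  · convert (ContinuousLinearMap.compL 𝕜 X X X S).hasSum h.2 using 1
    · ext k y
      simp
    · rfl

theorem IsNuclearRep.mul_right {T : X →L[𝕜] X} {f : ℕ → StrongDual 𝕜 X} {x : ℕ → X}
    (h : IsNuclearRep T f x) (S : X →L[𝕜] X) :
    IsNuclearRep (T * S) (fun k => (f k).comp S) x := by
  refine ⟨?_, ?_⟩
  · refine Summable.of_nonneg_of_le (fun k => by positivity) (fun k => ?_) (h.1.mul_left ‖S‖)
    calc ‖(f k).comp S‖ * ‖x k‖ ≤ (‖f k‖ * ‖S‖) * ‖x k‖ := by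
          gcongr; exact (f k).opNorm_comp_le S
      _ = ‖S‖ * (‖f k‖ * ‖x k‖) := by ring
  · convert ((ContinuousLinearMap.compL 𝕜 X X X).flip S).hasSum h.2 using 1 <;> rfl

/-- Cyclicity of the trace, `tr (T S) = tr (S T)`: both composites of a nuclear operator with a
bounded one have representations with the same trace series `∑ f k (S (x k))`. -/
theorem IsNuclear.exists_hasTraceRep_mul_comm {T : X →L[𝕜] X} (h : IsNuclear T)
    (S : X →L[𝕜] X) : ∃ c, HasTraceRep (T * S) c ∧ HasTraceRep (S * T) c := by
  obtain ⟨f, x, h⟩ := h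
  have hs := (h.mul_left S).summable_apply.hasSum
  exact ⟨_, ⟨_, _, h.mul_right S, hs⟩, ⟨_, _, h.mul_left S, hs⟩⟩

theorem IsNuclear.mul_left {T : X →L[𝕜] X} (h : IsNuclear T) (S : X →L[𝕜] X) :
    IsNuclear (S * T) := by
  obtain ⟨f, x, h⟩ := h
  exact ⟨_, _, h.mul_left S⟩

theorem HasTraceRep.neg {T : X →L[𝕜] X} {c : 𝕜} (h : HasTraceRep T c) :
    HasTraceRep (-T) (-c) := by
  obtain ⟨f, x, h, hc⟩ := h
  have h' := h.mul_left (-1)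
  rw [neg_one_mul] at h'
  refine ⟨_, _, h', ?_⟩
  simpa using hc.neg

/-- The trace of an operator that factors through a finite-dimensional space. -/
theorem hasTraceRep_comp {V : Type*} [NormedAddCommGroup V] [NormedSpace 𝕜 V]
    [FiniteDimensional 𝕜 V] (α : X →L[𝕜] V) (β : V →L[𝕜] X) :
    HasTraceRep (β ∘L α) (LinearMap.trace 𝕜 V ((α ∘L β : V →L[𝕜] V) : V →ₗ[𝕜] V)) := by
  let b := Module.finBasis 𝕜 V
  let g (j) : StrongDual 𝕜 X := (LinearMap.toContinuousLinearMap (b.coord j)).comp α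
  have h := hasTraceRep_sum Finset.univ (fun j => (g j).smulRight (β (b j)))
    (fun j => g j (β (b j))) fun j _ => hasTraceRep_smulRight _ _
  convert h using 1
  · ext x
    have := congrArg β (b.sum_repr (α x))
    rw [map_sum] at this
    simpa [g] using this.symm
  · rw [LinearMap.trace_eq_matrix_trace 𝕜 b]
    simp [Matrix.trace, LinearMap.toMatrix_apply, g]

/-- For `A` of finite rank, the series `∑ f k (A (x k))` depends on `T = ∑ f k ⊗ x k` only: its sum
is the trace of `A T` on the finite-dimensional range of `A`. -/
theorem IsNuclearRep.hasSum_apply_finiteRank {T : X →L[𝕜] X} {f : ℕ → StrongDual 𝕜 X}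
    {x : ℕ → X} (h : IsNuclearRep T f x) (A : X →L[𝕜] X)
    [FiniteDimensional 𝕜 (LinearMap.range (A : X →ₗ[𝕜] X))] :
    HasSum (fun k => f k (A (x k))) (LinearMap.trace 𝕜 (LinearMap.range (A : X →ₗ[𝕜] X))
      ((A : X →ₗ[𝕜] X).rangeRestrict ∘ₗ (T : X →ₗ[𝕜] X) ∘ₗ Submodule.subtype _)) := by
  let V := LinearMap.range (A : X →ₗ[𝕜] X)
  let A₀ : X →L[𝕜] V := A.codRestrict V fun x => LinearMap.mem_range_self (A : X →ₗ[𝕜] X) x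
  let b := Module.finBasis 𝕜 V
  let g (j) : StrongDual 𝕜 X := (LinearMap.toContinuousLinearMap (b.coord j)).comp A₀
  have h1 : ∀ j, HasSum (fun k => f k (b j) * g j (x k)) (g j (T (b j))) := fun j => by
    have := (((ContinuousLinearMap.apply 𝕜 X (b j : X)).hasSum h.2).mapL (g j))
    simpa using this
  have h2 := hasSum_sum (s := Finset.univ) fun j _ => h1 j
  convert h2 using 1
  · ext k
    have : A (x k) = ∑ j, g j (x k) • (b j : X) := by
      have := congrArg (Submodule.subtype V) (b.sum_repr (A₀ (x k)))
      rw [map_sum] at this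
      simpa [A₀, g] using this.symm
    rw [this]
    simp [mul_comm]
  · rw [LinearMap.trace_eq_matrix_trace 𝕜 b]
    simp only [Matrix.trace, Matrix.diag, LinearMap.toMatrix_apply]
    rfl

theorem isCompactOperator_smulRight (f : StrongDual 𝕜 X) (x : X) :
    IsCompactOperator (f.smulRight x) :=
  (isCompactOperator_of_locallyCompactSpace_rng
    (T := ContinuousLinearMap.toSpanSingleton 𝕜 x)).comp_clm f

theorem IsNuclear.isCompactOperator [CompleteSpace X] {T : X →L[𝕜] X} (h : IsNuclear T) :
    IsCompactOperator T := by
  obtain ⟨f, x, h⟩ := h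
  refine isCompactOperator_of_tendsto h.2 (Eventually.of_forall fun s => ?_)
  exact Submodule.sum_mem (compactOperator (RingHom.id 𝕜) X X)
    fun k _ => isCompactOperator_smulRight (f k) (x k)

end Trace

/-! ### Uniqueness of the trace under the approximation property -/

section Uniqueness

/-- A summable nonnegative series stays summable after multiplication by suitable positive weights
that tend to infinity (du Bois-Reymond). -/
theorem exists_tendsto_atTop_summable_mul {a : ℕ → ℝ} (ha : ∀ k, 0 ≤ a k) (hs : Summable a) :
    ∃ c : ℕ → ℝ, (∀ k, 0 < c k) ∧ Tendsto c atTop atTop ∧ Summable fun k => c k * a k := by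
  -- Adding a geometric series makes all tails `r k` positive; the weights are `1 / √(r k)`.
  let a' : ℕ → ℝ := fun k => a k + (1 / 2) ^ k
  have ha' : ∀ k, 0 < a' k := fun k => add_pos_of_nonneg_of_pos (ha k) (by positivity)
  have hs' : Summable a' := hs.add summable_geometric_two
  let r : ℕ → ℝ := fun k => ∑' j, a' (j + k)
  have hsk : ∀ k, Summable fun j => a' (j + k) := fun k => (summable_nat_add_iff k).2 hs'
  have hr : ∀ k, 0 < r k := fun k => (hsk k).tsum_pos (fun j => (ha' _).le) 0 (ha' _)
  have hrec : ∀ k, r k = a' k + r (k + 1) := fun k => by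
    have := (hsk k).tsum_eq_zero_add
    simp only [zero_add] at this
    rw [show r k = _ from this]
    congr 1
    exact tsum_congr fun j => by rw [add_right_comm, add_assoc]
  have hr0 : Tendsto r atTop (𝓝 0) := tendsto_sum_nat_add a'
  have hsq0 : Tendsto (fun k => √(r k)) atTop (𝓝[>] 0) := by
    refine tendsto_nhdsWithin_iff.2 ⟨?_, Eventually.of_forall fun k => Real.sqrt_pos.2 (hr k)⟩
    have := (Real.continuous_sqrt.tendsto 0).comp hr0
    rwa [Real.sqrt_zero] at this
  have hpos : ∀ k, 0 < √(r k) := fun k => Real.sqrt_pos.2 (hr k)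
  refine ⟨fun k => (√(r k))⁻¹, fun k => inv_pos.2 (hpos k), hsq0.inv_tendsto_nhdsGT_zero, ?_⟩
  have key : ∀ k, (√(r k))⁻¹ * a k ≤ 2 * (√(r k) - √(r (k + 1))) := fun k => by
    rw [inv_mul_le_iff₀ (hpos k)]
    have h1 := Real.mul_self_sqrt (hr k).le
    have h2 := Real.mul_self_sqrt (hr (k + 1)).le
    have h3 : a k ≤ r k - r (k + 1) := by
      have : a k ≤ a' k := le_add_of_nonneg_right (by positivity)
      linarith [hrec k]
    nlinarith [sq_nonneg (√(r k) - √(r (k + 1)))]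
  refine summable_of_sum_range_le (c := 2 * √(r 0))
    (fun k => mul_nonneg (inv_nonneg.2 (hpos k).le) (ha k)) fun n => ?_
  calc ∑ i ∈ Finset.range n, (√(r i))⁻¹ * a i
      ≤ ∑ i ∈ Finset.range n, 2 * (√(r i) - √(r (i + 1))) := Finset.sum_le_sum fun k _ => key k
    _ = 2 * (√(r 0) - √(r n)) := by rw [← Finset.mul_sum, Finset.sum_range_sub']
    _ ≤ 2 * √(r 0) := by linarith [hpos n]

variable {𝕜 X : Type*} [RCLike 𝕜] [NormedAddCommGroup X] [NormedSpace 𝕜 X]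

/-- The trace series of a nuclear representation is controlled on a compact set: replacing each
`x k` by `A (x k)`, with `A` uniformly close to the identity there, changes the trace little. -/
theorem IsNuclearRep.exists_isCompact {T : X →L[𝕜] X} {f : ℕ → StrongDual 𝕜 X} {x : ℕ → X}
    (h : IsNuclearRep T f x) : ∃ (K : Set X) (M : ℝ), IsCompact K ∧ 0 ≤ M ∧
      ∀ ε : ℝ, 0 < ε → ∀ A : X →L[𝕜] X, (∀ y ∈ K, ‖A y - y‖ < ε) → ∀ s c : 𝕜,
        HasSum (fun k => f k (A (x k))) s → HasSum (fun k => f k (x k)) c → ‖s - c‖ ≤ M * ε := by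
  obtain ⟨c, hc, hct, hcs⟩ := exists_tendsto_atTop_summable_mul (fun k => by positivity) h.1
  -- `f k ⊗ x k = g k ⊗ y k` where `y k → 0` and `∑ ‖g k‖ < ∞`.
  let y : ℕ → X := fun k => ((c k * ‖x k‖ : ℝ) : 𝕜)⁻¹ • x k
  have hy : ∀ k, ((c k * ‖x k‖ : ℝ) : 𝕜) • y k = x k := fun k => by
    by_cases hx : x k = 0
    · simp [y, hx]
    · refine smul_inv_smul₀ ?_ _
      have := (mul_pos (hc k) (norm_pos_iff.2 hx)).ne'
      exact_mod_cast this
  have hyn : ∀ k, ‖y k‖ ≤ (c k)⁻¹ := fun k => by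
    by_cases hx : x k = 0
    · simpa [y, hx] using (hc k).le
    · have hx' := norm_pos_iff.2 hx
      simp only [y, norm_smul, norm_inv, RCLike.norm_ofReal, abs_mul, abs_norm,
        abs_of_pos (hc k)]
      field_simp
      rfl
  have hy0 : Tendsto y atTop (𝓝 0) :=
    squeeze_zero_norm hyn (tendsto_inv_atTop_zero.comp hct)
  refine ⟨insert 0 (Set.range y), ∑' k, c k * (‖f k‖ * ‖x k‖), hy0.isCompact_insert_range,
    tsum_nonneg fun k => mul_nonneg (hc k).le (by positivity), ?_⟩
  intro ε hε A hA s t hs ht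
  have hst := hs.sub ht
  rw [← hst.tsum_eq, ← tsum_mul_right]
  refine tsum_of_norm_bounded (hcs.mul_right ε).hasSum fun k => ?_
  have h1 : f k (A (x k)) - f k (x k) = ((c k * ‖x k‖ : ℝ) : 𝕜) * f k (A (y k) - y k) := by
    rw [← smul_eq_mul, ← map_smul, smul_sub, ← map_smul, hy, map_sub]
  rw [h1, norm_mul, RCLike.norm_ofReal, abs_of_nonneg (by have := hc k; positivity)]
  calc c k * ‖x k‖ * ‖f k (A (y k) - y k)‖ ≤ c k * ‖x k‖ * (‖f k‖ * ε) := by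
        have := (hc k).le
        gcongr
        refine ((f k).le_opNorm _).trans ?_
        gcongr
        exact (hA _ (Set.mem_insert_of_mem _ ⟨k, rfl⟩)).le
    _ = c k * (‖f k‖ * ‖x k‖) * ε := by ring

/-- In a space with the approximation property the trace of a nuclear operator does not depend on
the representation: for `A` of finite rank and close to the identity, both trace series are close
to the trace of `A T`. -/
theorem HasTraceRep.eq_of_rep (hX : ApproximationProperty 𝕜 X) {T : X →L[𝕜] X} {c : 𝕜}
    (h : HasTraceRep T c) {f : ℕ → StrongDual 𝕜 X} {x : ℕ → X} (hr : IsNuclearRep T f x) {d : 𝕜}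
    (hd : HasSum (fun k => f k (x k)) d) : d = c := by
  obtain ⟨g, y, hr', hc⟩ := h
  obtain ⟨K, M, hK, hM, hKM⟩ := hr.exists_isCompact
  obtain ⟨K', M', hK', hM', hKM'⟩ := hr'.exists_isCompact
  refine eq_of_forall_dist_le fun ε hε => ?_
  let δ := ε / (M + M' + 1)
  have hδ : 0 < δ := by positivity
  obtain ⟨A, hA, hAK⟩ := hX (K ∪ K') (hK.union hK') δ hδ
  have h1 := hKM δ hδ A (fun z hz => hAK z (Or.inl hz)) _ _ (hr.hasSum_apply_finiteRank A) hd
  have h2 := hKM' δ hδ A (fun z hz => hAK z (Or.inr hz)) _ _ (hr'.hasSum_apply_finiteRank A) hc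
  rw [← dist_eq_norm] at h1 h2
  calc dist d c ≤ M * δ + M' * δ := (dist_triangle_left _ _ _).trans (add_le_add h1 h2)
    _ ≤ (M + M' + 1) * δ := by nlinarith
    _ = ε := by simp only [δ]; field_simp

theorem HasTraceRep.unique (hX : ApproximationProperty 𝕜 X) {T : X →L[𝕜] X} {c d : 𝕜}
    (h : HasTraceRep T c) (h' : HasTraceRep T d) : c = d := by
  obtain ⟨f, x, hr, hc⟩ := h
  exact h'.eq_of_rep hX hr hc

theorem HasTraceRep.hasNuclearTrace (hX : ApproximationProperty 𝕜 X) {T : X →L[𝕜] X} {c : 𝕜}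
    (h : HasTraceRep T c) : HasNuclearTrace T c := by
  refine ⟨?_, fun f x hr => ?_⟩
  · obtain ⟨f, x, hr, -⟩ := h
    exact ⟨f, x, hr⟩
  · have hs := hr.summable_apply.hasSum
    rwa [h.eq_of_rep hX hr hs] at hs

end Uniqueness

/-- Hilbert spaces have the approximation property: project orthogonally onto the span of a finite
`ε`-net. -/
theorem approximationProperty_of_innerProductSpace {𝕜 H : Type*} [RCLike 𝕜]
    [NormedAddCommGroup H] [InnerProductSpace 𝕜 H] : ApproximationProperty 𝕜 H := by
  intro K hK ε hε
  obtain ⟨t, -, htf, htK⟩ := hK.finite_cover_balls hε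
  let V : Submodule 𝕜 H := Submodule.span 𝕜 t
  have : FiniteDimensional 𝕜 V := FiniteDimensional.span_of_finite 𝕜 htf
  refine ⟨V.starProjection, ?_, fun x hx => ?_⟩
  · have : LinearMap.range (V.starProjection : H →ₗ[𝕜] H) = V := by
      simp
    rw [this]
    infer_instance
  · obtain ⟨y, hy, hxy⟩ := Set.mem_iUnion₂.1 (htK hx)
    have hyV : y ∈ V := Submodule.subset_span hy
    rw [norm_sub_rev, V.starProjection_minimal]
    refine (ciInf_le ⟨0, ?_⟩ (⟨y, hyV⟩ : V)).trans_lt ?_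
    · rintro _ ⟨z, rfl⟩
      exact norm_nonneg _
    · simpa [dist_eq_norm] using hxy

/-! ### Riesz theory of compact perturbations of the identity -/

section Riesz

variable {𝕜 X : Type*} [RCLike 𝕜] [NormedAddCommGroup X] [NormedSpace 𝕜 X]

/-- The kernels of the powers of a compact perturbation of the identity stabilize: otherwise Riesz's
lemma yields a bounded sequence whose image under `K` is uniformly separated. -/
theorem exists_pow_succ_apply_eq_zero_imp {K : X →L[𝕜] X} (hK : IsCompactOperator K) :
    ∃ N : ℕ, ∀ x, ((1 - K) ^ (N + 1)) x = 0 → ((1 - K) ^ N) x = 0 := by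
  by_contra! h
  let L : X →L[𝕜] X := 1 - K
  let V : ℕ → Submodule 𝕜 X := fun n => LinearMap.ker ((L ^ n : X →L[𝕜] X) : X →ₗ[𝕜] X)
  have hVmem : ∀ n x, x ∈ V n ↔ (L ^ n) x = 0 := fun n x => LinearMap.mem_ker
  have hLV : ∀ n x, x ∈ V (n + 1) → L x ∈ V n := fun n x hx => by
    rw [hVmem, pow_succ] at hx
    exact (hVmem _ _).2 hx
  have hmono : Monotone V := monotone_nat_of_le_succ fun n x hx => by
    rw [hVmem] at hx ⊢
    rw [pow_succ', mul_apply_eq_comp, hx, map_zero]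
  have hc : (1 : ℝ) < ‖(2 : 𝕜)‖ := by simp
  have hR : ‖(2 : 𝕜)‖ < 3 := by simp; norm_num
  have hx : ∀ n, ∃ x ∈ V (n + 1), ‖x‖ ≤ 3 ∧ ∀ y ∈ V n, 1 ≤ ‖x - y‖ := fun n => by
    have h₁ : IsClosed (((V n).comap (V (n + 1)).subtype : Submodule 𝕜 (V (n + 1))) :
        Set (V (n + 1))) :=
      (L ^ n).isClosed_ker.preimage continuous_subtype_val
    obtain ⟨z, hz, hz'⟩ := h n
    obtain ⟨⟨x, hx⟩, hxn, hxy⟩ := riesz_lemma_of_norm_lt hc hR h₁ ⟨⟨z, (hVmem _ _).2 hz⟩, hz'⟩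
    exact ⟨x, hx, hxn, fun y hy => hxy ⟨y, hmono n.le_succ hy⟩ hy⟩
  choose f hf hfn hfar using hx
  have hsep : ∀ m n, m < n → 1 ≤ ‖K (f n) - K (f m)‖ := fun m n hmn => by
    have hmem : L (f n) + f m - L (f m) ∈ V n :=
      Submodule.sub_mem _ (Submodule.add_mem _ (hLV _ _ (hf n)) (hmono hmn (hf m)))
        (hmono hmn.le (hLV _ _ (hf m)))
    have hKL : ∀ x, K x = x - L x := fun x => by simp [L]
    have := hfar n _ hmem
    rwa [show f n - (L (f n) + f m - L (f m)) = K (f n) - K (f m) by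
      rw [hKL, hKL]; abel] at this
  obtain ⟨C, hC, hC'⟩ := hK.image_closedBall_subset_compact 3
  obtain ⟨y, -, ψ, hψ, hψy⟩ := hC.tendsto_subseq
    (x := fun n => K (f n)) (fun n => hC' ⟨f n, by simpa using hfn n, rfl⟩)
  obtain ⟨N, hN⟩ := Metric.cauchySeq_iff'.1 hψy.cauchySeq 1 one_pos
  have h1 := hN (N + 1) N.le_succ
  rw [Function.comp_apply, Function.comp_apply, dist_eq_norm] at h1
  exact (hsep _ _ (hψ N.lt_succ_self)).not_gt h1

theorem exists_pow_one_sub_eq {K : X →L[𝕜] X} (hK : IsCompactOperator K) (N : ℕ) :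
    ∃ K' : X →L[𝕜] X, IsCompactOperator K' ∧ (1 - K) ^ N = 1 - K' := by
  induction N with
  | zero => exact ⟨0, isCompactOperator_zero, by simp⟩
  | succ N ih =>
    obtain ⟨K', hK', h⟩ := ih
    have hc : IsCompactOperator ((1 - K') ∘L K) :=
      hK.continuous_comp (1 - K').continuous
    refine ⟨K' + (1 - K') ∘L K, hK'.add hc, ?_⟩
    rw [pow_succ, h]
    change (1 - K') * (1 - K) = 1 - (K' + (1 - K') * K)
    noncomm_ring

theorem finiteDimensional_ker_one_sub {K : X →L[𝕜] X} (hK : IsCompactOperator K) :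
    FiniteDimensional 𝕜 (LinearMap.ker ((1 - K : X →L[𝕜] X) : X →ₗ[𝕜] X)) := by
  set V := LinearMap.ker ((1 - K : X →L[𝕜] X) : X →ₗ[𝕜] X) with hV
  have hfix : ∀ x ∈ V, K x = x := fun x hx => by
    have : x - K x = 0 := LinearMap.mem_ker.1 hx
    exact (sub_eq_zero.1 this).symm
  have hmaps : ∀ x ∈ V, (K : X →ₗ[𝕜] X) x ∈ V := fun x hx => by
    rw [ContinuousLinearMap.coe_coe, hfix x hx]; exact hx
  have hcl : IsClosed (V : Set X) := (1 - K).isClosed_ker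
  have h := IsCompactOperator.restrict (f := (K : X →ₗ[𝕜] X)) hK hmaps hcl
  refine FiniteDimensional.of_isCompactOperator_id (𝕜 := 𝕜) ?_
  have hid : (id : V → V) = (K : X →ₗ[𝕜] X).restrict hmaps :=
    funext fun x => Subtype.ext (hfix x x.2).symm
  rw [hid]
  exact h

theorem exists_inverse_of_injective [CompleteSpace X] {K : X →L[𝕜] X} (hK : IsCompactOperator K)
    (hinj : ∀ x, (1 - K) x = 0 → x = 0) :
    ∃ W : X →L[𝕜] X, (1 - K) * W = 1 ∧ W * (1 - K) = 1 := by
  have h : (1 : 𝕜) ∈ resolventSet 𝕜 K := by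
    refine (hK.hasEigenvalue_or_mem_resolventSet one_ne_zero).resolve_left fun hev => ?_
    obtain ⟨x, hx⟩ := hev.exists_hasEigenvector
    have h1 : K x = x := by simpa using hx.apply_eq_smul
    exact hx.2 (hinj x (by simp [h1]))
  rw [spectrum.mem_resolventSet_iff, map_one] at h
  obtain ⟨u, hu⟩ := h
  exact ⟨↑u⁻¹, by rw [← hu, Units.mul_inv], by rw [← hu, Units.inv_mul]⟩

/-- The Riesz decomposition of a compact perturbation `L = 1 - K` of the identity: `R` is the
projection onto the finite-dimensional space `⋃ ker (L ^ k)` along `⋂ range (L ^ k)`, and `D`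
inverts `L` on the latter. Both commute with everything that commutes with `L`. -/
theorem exists_riesz_decomposition [CompleteSpace X] {K : X →L[𝕜] X} (hK : IsCompactOperator K) :
    ∃ R D : X →L[𝕜] X, IsIdempotentElem R ∧
      FiniteDimensional 𝕜 (LinearMap.range (R : X →ₗ[𝕜] X)) ∧
      D * (1 - K) = 1 - R ∧ ∀ C : X →L[𝕜] X, Commute C (1 - K) → Commute C R ∧ Commute C D := by
  obtain ⟨N, hN⟩ := exists_pow_succ_apply_eq_zero_imp hK
  set L : X →L[𝕜] X := 1 - K with hL
  have hNk : ∀ k x, (L ^ (N + k)) x = 0 → (L ^ N) x = 0 := fun k => by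
    induction k with
    | zero => exact fun x hx => hx
    | succ k ih =>
      intro x hx
      refine ih x ?_
      rw [show N + (k + 1) = (N + 1) + k by ring, pow_add] at hx
      rw [pow_add]
      exact hN _ hx
  obtain ⟨K', hK', hLK'⟩ := exists_pow_one_sub_eq hK (N + 1)
  rw [← hL] at hLK'
  set S : X →L[𝕜] X := L ^ (N + 1) with hS
  have hSS : ∀ x, S (S x) = 0 → S x = 0 := fun x hx => by
    rw [← mul_apply_eq_comp, hS, ← pow_add, add_assoc] at hx
    have := hNk _ x hx
    rw [hS, pow_succ', mul_apply_eq_comp, this, map_zero]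
  -- For any projection `p` onto `ker S`, the operator `S + p` is invertible.
  have hinv : ∀ p : X →L[𝕜] X, IsCompactOperator p → (∀ x, S (p x) = 0) →
      (∀ x, S x = 0 → p x = x) → ∃ W : X →L[𝕜] X, (S + p) * W = 1 ∧ W * (S + p) = 1 := by
    intro p hp hp1 hp2
    have heq : S + p = 1 - (K' - p) := by rw [hLK']; abel
    rw [heq]
    refine exists_inverse_of_injective (hK'.sub hp) fun x hx => ?_
    rw [← heq, add_apply] at hx
    have h1 : S x = 0 := hSS x (by
      have := congrArg S hx
      rwa [map_add, hp1, add_zero, map_zero] at this)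
    rw [h1, zero_add, hp2 x h1] at hx
    exact hx
  have hfin : FiniteDimensional 𝕜 (LinearMap.ker (S : X →ₗ[𝕜] X)) := by
    rw [hLK']
    exact finiteDimensional_ker_one_sub hK'
  have hVmem : ∀ x, x ∈ LinearMap.ker (S : X →ₗ[𝕜] X) ↔ S x = 0 := fun x => LinearMap.mem_ker
  set V := LinearMap.ker (S : X →ₗ[𝕜] X)
  have hcpt : ∀ q : X →L[𝕜] V, IsCompactOperator (V.subtypeL ∘L q) := fun q =>
    (isCompactOperator_of_locallyCompactSpace_rng (T := V.subtypeL)).comp_clm q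
  obtain ⟨q, hq⟩ := Submodule.ClosedComplemented.of_finiteDimensional V
  obtain ⟨U, hU1, hU2⟩ := hinv (V.subtypeL ∘L q) (hcpt q) (fun x => (hVmem _).1 (q x).2)
    fun x hx => congrArg Subtype.val (hq ⟨x, (hVmem x).2 hx⟩)
  -- The projection onto `ker S` along `range S`.
  let R : X →L[𝕜] X := V.subtypeL ∘L (q ∘L U)
  have hRS : 1 - R = S * U := by
    rw [← hU1, add_mul]
    exact add_sub_cancel_right _ _
  have hSR : ∀ x, S (R x) = 0 := fun x => (hVmem _).1 (q (U x)).2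
  have hRfix : ∀ x, S x = 0 → R x = x := fun x hx => by
    have hx1 : (S + V.subtypeL ∘L q) x = x := by
      rw [add_apply, hx, zero_add]
      exact congrArg Subtype.val (hq ⟨x, (hVmem x).2 hx⟩)
    have hx2 : U x = x := by
      have := congrArg (fun T : X →L[𝕜] X => T x) hU2
      simp only [mul_apply_eq_comp, hx1] at this
      exact this
    change ((q (U x) : V) : X) = x
    rw [hx2]
    exact congrArg Subtype.val (hq ⟨x, (hVmem x).2 hx⟩)
  -- `R` vanishes on `range S`, hence is the projection along it.
  have hRSz : ∀ z, R (S z) = 0 := fun z => by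
    -- `S z - R (S z)` lies in the range of `S`, so `R (S z)` does;
    -- being also in `ker S`, it is `0`.
    have h1 : R (S z) = S (z - U (S z)) := by
      have := congrArg (fun T : X →L[𝕜] X => T (S z)) hRS
      simp only [sub_apply, one_apply_eq_self,
        mul_apply_eq_comp] at this
      rw [map_sub, ← this]; abel
    rw [h1]
    exact hSS _ (by rw [← h1]; exact hSR _)
  have hRmul : R * R = R := by
    ext x; exact hRfix _ (hSR x)
  have hRS0 : R * S = 0 := by ext x; exact hRSz x
  have hcommR : ∀ C : X →L[𝕜] X, Commute C L → Commute C R := fun C hC => by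
    have hCS : C * S = S * C := hC.pow_right (N + 1)
    have h1 : R * C * R = C * R := by
      ext x
      refine hRfix _ ?_
      change (S * C) (R x) = 0
      rw [← hCS, mul_apply_eq_comp, hSR, map_zero]
    have h2 : R * C * (1 - R) = 0 := by
      rw [hRS, show R * C * (S * U) = R * (C * S) * U by noncomm_ring, hCS,
        show R * (S * C) * U = (R * S) * C * U by noncomm_ring, hRS0, zero_mul, zero_mul]
    rw [mul_sub, mul_one, h1, sub_eq_zero] at h2
    exact h2.symm
  -- Since `R` commutes with `L`, unlike an arbitrary projection onto `ker S`, so does the inverse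
  -- `W` of `S + R`.
  obtain ⟨W, hW1, hW2⟩ := hinv R (hcpt (q ∘L U)) hSR hRfix
  have hcommW : ∀ C : X →L[𝕜] X, Commute C L → Commute C W := fun C hC => by
    have hC' : C * (S + R) = (S + R) * C :=
      (Commute.add_right (hC.pow_right (N + 1)) (hcommR C hC))
    calc C * W = W * (S + R) * C * W := by rw [hW2, one_mul]
      _ = W * ((S + R) * C) * W := by noncomm_ring
      _ = W * C * ((S + R) * W) := by rw [← hC']; noncomm_ring
      _ = W * C := by rw [hW1, mul_one]
  refine ⟨R, W * L ^ N * (1 - R), hRmul, ?_, ?_, fun C hC => ⟨hcommR C hC, ?_⟩⟩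
  · refine Submodule.finiteDimensional_of_le (S₂ := V) ?_
    rintro _ ⟨x, rfl⟩
    exact (q (U x)).2
  · have hLR : (1 - R) * L = L * (1 - R) :=
      ((Commute.one_left L).sub_left (hcommR L (Commute.refl L)).symm).eq
    have hWS : W * S * (1 - R) = W * (S + R) * (1 - R) := by
      have : R * (1 - R) = 0 := by rw [mul_sub, hRmul, mul_one, sub_self]
      rw [mul_add, add_mul, mul_assoc W R, this, mul_zero, add_zero]
    rw [mul_assoc, hLR, ← mul_assoc, mul_assoc W, ← pow_succ, ← hS, hWS, hW2, one_mul]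
  · exact ((hcommW C hC).mul_right (hC.pow_right N)).mul_right
      ((Commute.one_right C).sub_right (hcommR C hC))

end Riesz

/-! ### Algebra of a pair of idempotents -/

section Algebra

variable {A : Type*} [Ring A] {p q : A}

theorem sub_sq_of_isIdempotentElem (hp : IsIdempotentElem p) (hq : IsIdempotentElem q) :
    (p - q) ^ 2 = 1 - (1 - p - q) ^ 2 := by
  have e1 : (p - q) ^ 2 = p * p + q * q - p * q - q * p := by noncomm_ring
  have e2 : (1 - p - q) ^ 2 = 1 - p - p - q - q + p * p + q * q + p * q + q * p := by
    noncomm_ring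
  rw [e1, e2, hp.eq, hq.eq]
  abel

theorem compl_mul_sub_of_isIdempotentElem (hp : IsIdempotentElem p) (hq : IsIdempotentElem q) :
    (1 - p - q) * (p - q) = -((p - q) * (1 - p - q)) := by
  have e1 : (1 - p - q) * (p - q) = p - q - p * p + p * q - q * p + q * q := by noncomm_ring
  have e2 : (p - q) * (1 - p - q) = p - q - p * p - p * q + q * p + q * q := by noncomm_ring
  rw [e1, e2, hp.eq, hq.eq]
  abel

theorem commute_sub_sq_left (hp : IsIdempotentElem p) (hq : IsIdempotentElem q) :
    Commute p ((p - q) ^ 2) := by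
  have e1 : p * (p - q) ^ 2 = p * p * p - p * p * q - p * q * p + p * (q * q) := by noncomm_ring
  have e2 : (p - q) ^ 2 * p = p * p * p - q * (p * p) - p * q * p + q * q * p := by noncomm_ring
  rw [Commute, SemiconjBy, e1, e2, hp.eq, hq.eq, hp.eq]
  abel

theorem commute_sub_sq_right (hp : IsIdempotentElem p) (hq : IsIdempotentElem q) :
    Commute q ((p - q) ^ 2) := by
  rw [← neg_sub q p, neg_sq]
  exact commute_sub_sq_left hq hp

theorem compl_mul_sub_pow_of_odd (hp : IsIdempotentElem p) (hq : IsIdempotentElem q) {n : ℕ}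
    (hn : Odd n) : (1 - p - q) * (p - q) ^ n = -((p - q) ^ n * (1 - p - q)) := by
  obtain ⟨m, rfl⟩ := hn
  have hc : Commute (1 - p - q) ((p - q) ^ (2 * m)) := by
    rw [pow_mul]
    exact (((Commute.one_left _).sub_left (commute_sub_sq_left hp hq)).sub_left
      (commute_sub_sq_right hp hq)).pow_right m
  rw [pow_succ, ← mul_assoc, hc.eq, mul_assoc, compl_mul_sub_of_isIdempotentElem hp hq, mul_neg,
    mul_assoc]

end Algebra

/-! ### Traces and dimensions in finite-dimensional spaces -/

section FiniteDim

variable {K V : Type*} [Field K] [AddCommGroup V] [Module K V] {p q : Module.End K V}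

/-- Odd powers of a difference of idempotents have the same trace: with `a = p - q` and
`b = 1 - p - q` one has `a ^ (n + 2) = a ^ n - a ^ n * b * b`, and the trace of the last term
vanishes by cyclicity because `b` anticommutes with `a ^ n`. -/
theorem trace_sub_pow_of_odd [CharZero K]
    (hp : IsIdempotentElem p) (hq : IsIdempotentElem q) {n : ℕ}
    (hn : Odd n) : LinearMap.trace K V ((p - q) ^ n) = LinearMap.trace K V (p - q) := by
  obtain ⟨m, rfl⟩ := hn
  induction m with
  | zero => simp
  | succ m ih =>
    have h1 : (p - q) ^ (2 * (m + 1) + 1) = (p - q) ^ (2 * m + 1) -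
        (p - q) ^ (2 * m + 1) * (1 - p - q) * (1 - p - q) := by
      rw [show 2 * (m + 1) + 1 = (2 * m + 1) + 2 by ring, pow_add,
        sub_sq_of_isIdempotentElem hp hq]
      noncomm_ring
    have h2 : LinearMap.trace K V ((p - q) ^ (2 * m + 1) * (1 - p - q) * (1 - p - q)) = 0 := by
      refine self_eq_neg.1 ?_
      conv_lhs => rw [LinearMap.trace_mul_comm, ← mul_assoc,
        compl_mul_sub_pow_of_odd hp hq ⟨m, rfl⟩, neg_mul, map_neg]
    rw [h1, map_sub, ih, h2, sub_zero]

/-- The trace of `p - q` is `dim (range p ⊓ ker q) - codim (range p ⊔ ker q)`. -/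
theorem trace_sub_eq_finrank_sub_finrank [FiniteDimensional K V]
    (hp : IsIdempotentElem p) (hq : IsIdempotentElem q) :
    LinearMap.trace K V (p - q) =
      (((Module.finrank K (LinearMap.range p ⊓ LinearMap.ker q : Submodule K V) : ℤ) -
        (Module.finrank K
          (LinearMap.range p ⊔ LinearMap.ker q : Submodule K V).dualAnnihilator : ℤ) : ℤ) : K) := by
  have h1 := Submodule.finrank_sup_add_finrank_inf_eq (LinearMap.range p) (LinearMap.ker q)
  have h2 := Subspace.finrank_add_finrank_dualAnnihilator_eq
    (LinearMap.range p ⊔ LinearMap.ker q : Submodule K V)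
  have h3 := LinearMap.finrank_range_add_finrank_ker q
  rw [map_sub, (LinearMap.IsIdempotentElem.isProj_range p hp).trace,
    (LinearMap.IsIdempotentElem.isProj_range q hq).trace]
  have h4 : (Module.finrank K (LinearMap.range p ⊓ LinearMap.ker q : Submodule K V) : ℤ) -
      (Module.finrank K
        (LinearMap.range p ⊔ LinearMap.ker q : Submodule K V).dualAnnihilator : ℤ) =
      (Module.finrank K (LinearMap.range p) : ℤ) - (Module.finrank K (LinearMap.range q) : ℤ) := by
    omega
  rw [h4, Int.cast_sub, Int.cast_natCast, Int.cast_natCast]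

end FiniteDim

/-! ### Joint eigenspaces as subspaces of a finite-dimensional summand -/

section Index

variable {𝕜 X : Type*} [RCLike 𝕜] [NormedAddCommGroup X] [NormedSpace 𝕜 X]

theorem jointEigenspace_swap (P Q : X →L[𝕜] X) (a b : 𝕜) :
    jointEigenspace P Q a b = jointEigenspace Q P b a := by
  ext x
  exact and_comm

theorem mem_jointEigenspace_dualOp {P Q : X →L[𝕜] X} {a b : 𝕜} {φ : StrongDual 𝕜 X} :
    φ ∈ jointEigenspace (dualOp P) (dualOp Q) a b ↔
      (∀ x, φ (P x) = a * φ x) ∧ ∀ x, φ (Q x) = b * φ x :=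
  and_congr ContinuousLinearMap.ext_iff ContinuousLinearMap.ext_iff

variable {P Q : X →L[𝕜] X} {V : Submodule 𝕜 X}

theorem jointEigenspace_one_zero_eq_map (hP : IsIdempotentElem P)
    (hPV : ∀ x ∈ V, (P : X →ₗ[𝕜] X) x ∈ V) (hQV : ∀ x ∈ V, (Q : X →ₗ[𝕜] X) x ∈ V)
    (hV : jointEigenspace P Q 1 0 ≤ V) :
    jointEigenspace P Q (1 : 𝕜) 0 =
      (LinearMap.range ((P : X →ₗ[𝕜] X).restrict hPV) ⊓
        LinearMap.ker ((Q : X →ₗ[𝕜] X).restrict hQV)).map V.subtype := by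
  ext x
  constructor
  · intro hx
    have ⟨h1, h2⟩ : P x = (1 : 𝕜) • x ∧ Q x = (0 : 𝕜) • x := hx
    rw [one_smul] at h1
    rw [zero_smul] at h2
    exact ⟨⟨x, hV hx⟩, ⟨⟨⟨x, hV hx⟩, Subtype.ext h1⟩, Subtype.ext h2⟩, rfl⟩
  · rintro ⟨_, ⟨⟨y, rfl⟩, hy⟩, rfl⟩
    have h2 : Q (P y) = 0 := congrArg Subtype.val hy
    refine ⟨?_, ?_⟩
    · rw [one_smul]
      exact congrArg (fun T : X →L[𝕜] X => T y) hP
    · rw [zero_smul]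
      exact h2

/-- Functionals in the joint eigenspace of the duals that factor through the projection `R` onto
`V` are the functionals on `V` vanishing on `range P ⊔ ker Q`. -/
theorem nonempty_dual_jointEigenspace_equiv [FiniteDimensional 𝕜 V] (hQ : IsIdempotentElem Q)
    (hPV : ∀ x ∈ V, (P : X →ₗ[𝕜] X) x ∈ V) (hQV : ∀ x ∈ V, (Q : X →ₗ[𝕜] X) x ∈ V)
    (r : X →L[𝕜] V) (hr : ∀ x : V, r x = x)
    (hrP : ∀ x, (r (P x) : X) = P (r x)) (hrQ : ∀ x, (r (Q x) : X) = Q (r x))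
    (hφ : ∀ φ ∈ jointEigenspace (dualOp P) (dualOp Q) (0 : 𝕜) 1, ∀ x, φ (r x) = φ x) :
    Nonempty (jointEigenspace (dualOp P) (dualOp Q) (0 : 𝕜) 1 ≃ₗ[𝕜]
      (LinearMap.range ((P : X →ₗ[𝕜] X).restrict hPV) ⊔
        LinearMap.ker ((Q : X →ₗ[𝕜] X).restrict hQV)).dualAnnihilator) := by
  have hmem : ∀ φ : StrongDual 𝕜 X, φ ∈ jointEigenspace (dualOp P) (dualOp Q) (0 : 𝕜) 1 ↔
      (∀ x, φ (P x) = 0) ∧ ∀ x, φ (Q x) = φ x := fun φ => by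
    rw [mem_jointEigenspace_dualOp]
    simp only [zero_mul, one_mul]
  let res : StrongDual 𝕜 X →ₗ[𝕜] Module.Dual 𝕜 V :=
    { toFun := fun φ => (φ : X →ₗ[𝕜] 𝕜) ∘ₗ V.subtype
      map_add' := fun _ _ => rfl
      map_smul' := fun _ _ => rfl }
  have hres : ∀ φ : jointEigenspace (dualOp P) (dualOp Q) (0 : 𝕜) 1, res φ ∈
      (LinearMap.range ((P : X →ₗ[𝕜] X).restrict hPV) ⊔
        LinearMap.ker ((Q : X →ₗ[𝕜] X).restrict hQV)).dualAnnihilator := by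
    rintro ⟨φ, hφ'⟩
    obtain ⟨h1, h2⟩ := (hmem φ).1 hφ'
    rw [Submodule.dualAnnihilator_sup_eq]
    refine ⟨(Submodule.mem_dualAnnihilator _).2 ?_, (Submodule.mem_dualAnnihilator _).2 ?_⟩
    · rintro _ ⟨y, rfl⟩
      exact h1 y
    · intro y hy
      have hy' : Q y = 0 := congrArg Subtype.val hy
      change φ y = 0
      rw [← h2, hy', map_zero]
  refine ⟨LinearEquiv.ofBijective ((res.domRestrict _).codRestrict _ hres) ⟨?_, ?_⟩⟩
  · intro φ ψ h
    have h' : res φ = res ψ := congrArg Subtype.val h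
    refine Subtype.ext (ContinuousLinearMap.ext fun x => ?_)
    rw [← hφ φ φ.2, ← hφ ψ ψ.2]
    exact congrArg (fun T : Module.Dual 𝕜 V => T (r x)) h'
  · rintro ⟨ψ, hψ⟩
    rw [Submodule.dualAnnihilator_sup_eq] at hψ
    have hψP : ∀ y : V, ψ ((P : X →ₗ[𝕜] X).restrict hPV y) = 0 := fun y =>
      (Submodule.mem_dualAnnihilator _).1 hψ.1 _ ⟨y, rfl⟩
    have hψQ : ∀ y : V, ψ ((Q : X →ₗ[𝕜] X).restrict hQV y) = ψ y := fun y => by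
      rw [← sub_eq_zero, ← map_sub]
      refine (Submodule.mem_dualAnnihilator _).1 hψ.2 _ (Subtype.ext ?_)
      change Q (Q y - y) = 0
      rw [map_sub, sub_eq_zero]
      exact congrArg (fun T : X →L[𝕜] X => T y) hQ
    refine ⟨⟨(LinearMap.toContinuousLinearMap ψ).comp r, (hmem _).2 ⟨fun x => ?_, fun x => ?_⟩⟩, ?_⟩
    · change ψ (r (P x)) = 0
      rw [← hψP (r x)]
      exact congrArg ψ (Subtype.ext (hrP x))
    · change ψ (r (Q x)) = ψ (r x)
      rw [← hψQ (r x)]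
      exact congrArg ψ (Subtype.ext (hrQ x))
    · refine Subtype.ext (LinearMap.ext fun y => ?_)
      change ψ (r y) = ψ y
      rw [hr]

end Index

/-! ### The trace of an odd power of a difference of projections -/

section Banach

variable {𝕜 X : Type*} [RCLike 𝕜] [NormedAddCommGroup X] [NormedSpace 𝕜 X]

/-- On the range of `1 - R`, where `1 - (P - Q) ^ (2 * n)` and hence `B = 1 - P - Q` is invertible,
`B` conjugates `(P - Q) ^ n` into its negative. So the trace there vanishes. -/
theorem hasTraceRep_sub_pow_mul_compl (hX : ApproximationProperty 𝕜 X) {P Q R D : X →L[𝕜] X}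
    (hP : IsIdempotentElem P) (hQ : IsIdempotentElem Q) {n : ℕ} (hn : Odd n)
    (hT : IsNuclear ((P - Q) ^ n)) (hD : D * (1 - (P - Q) ^ (2 * n)) = 1 - R)
    (hcomm : ∀ C : X →L[𝕜] X, Commute C (1 - (P - Q) ^ (2 * n)) → Commute C R ∧ Commute C D) :
    HasTraceRep ((P - Q) ^ n * (1 - R)) 0 := by
  set B : X →L[𝕜] X := 1 - P - Q with hB
  set T := (P - Q) ^ n
  let G : X →L[𝕜] X := ∑ i ∈ Finset.range n, ((P - Q) ^ 2) ^ i
  have hBA : Commute B ((P - Q) ^ 2) :=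
    ((Commute.one_left _).sub_left (commute_sub_sq_left hP hQ)).sub_left
      (commute_sub_sq_right hP hQ)
  have hBG : Commute B G := Commute.sum_right _ _ _ fun i _ => hBA.pow_right i
  have hBBG : B * B * G = 1 - (P - Q) ^ (2 * n) := by
    have h1 : B * B = 1 - (P - Q) ^ 2 := by
      rw [sub_sq_of_isIdempotentElem hP hQ, ← hB, sq]; abel
    rw [h1, mul_neg_geom_sum, pow_mul]
  have hBL : Commute B (1 - (P - Q) ^ (2 * n)) := by
    rw [pow_mul]
    exact (Commute.one_right _).sub_right (hBA.pow_right n)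
  have hTL : Commute T (1 - (P - Q) ^ (2 * n)) :=
    (Commute.one_right _).sub_right (Commute.pow_pow_self _ _ _)
  -- `B'` inverts `B` on the range of `1 - R`.
  let B' : X →L[𝕜] X := D * G * B
  have hB'B : B' * B = 1 - R := by
    rw [← hD, ← hBBG]
    rw [(hBG.mul_left hBG).eq]
    simp only [B', mul_assoc]
  have hBB' : B * B' = 1 - R := by
    rw [← hB'B]
    exact (((hcomm B hBL).2.mul_right hBG).mul_right (Commute.refl B)).eq
  have hBT : B * T = -(T * B) := compl_mul_sub_pow_of_odd hP hQ hn
  have hTR : (1 - R) * T = T * (1 - R) :=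
    ((Commute.one_left T).sub_left (hcomm T hTL).1.symm).eq
  -- Cyclicity of the trace for `B * T` and `B'` compares `T * (1 - R)` with its negative.
  obtain ⟨c, hc1, hc2⟩ := (hT.mul_left B).exists_hasTraceRep_mul_comm B'
  rw [hBT, neg_mul, mul_assoc, hBB'] at hc1
  rw [← mul_assoc, hB'B, hTR] at hc2
  have h0 : c = 0 := self_eq_neg.1 (hc1.unique hX hc2.neg)
  rwa [h0] at hc2

/-- The trace of an odd power of a difference of projections as the index of the pair. -/
theorem hasTraceRep_sub_pow [CompleteSpace X] (hX : ApproximationProperty 𝕜 X) {P Q : X →L[𝕜] X}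
    (hP : IsIdempotentElem P) (hQ : IsIdempotentElem Q) {n : ℕ} (hn : Odd n)
    (hT : IsNuclear ((P - Q) ^ n)) :
    FiniteDimensional 𝕜 (jointEigenspace P Q (1 : 𝕜) 0) ∧
    FiniteDimensional 𝕜 (jointEigenspace (dualOp P) (dualOp Q) (0 : 𝕜) 1) ∧
    HasTraceRep ((P - Q) ^ n)
      (((Module.finrank 𝕜 (jointEigenspace P Q (1 : 𝕜) 0) : ℤ) -
        (Module.finrank 𝕜 (jointEigenspace (dualOp P) (dualOp Q) (0 : 𝕜) 1) : ℤ) : ℤ) : 𝕜) := by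
  have hK : IsNuclear ((P - Q) ^ (2 * n)) := by
    rw [two_mul, pow_add]
    exact hT.mul_left _
  obtain ⟨R, D, hR, hfin, hD, hcomm⟩ := exists_riesz_decomposition hK.isCompactOperator
  set L : X →L[𝕜] X := 1 - (P - Q) ^ (2 * n) with hL
  have hPL : Commute P L := by
    rw [hL, pow_mul]
    exact (Commute.one_right _).sub_right ((commute_sub_sq_left hP hQ).pow_right n)
  have hQL : Commute Q L := by
    rw [hL, pow_mul]
    exact (Commute.one_right _).sub_right ((commute_sub_sq_right hP hQ).pow_right n)
  have hLD : L * D = 1 - R := by rw [← hD, (hcomm L (Commute.refl L)).2.eq]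
  have hPR : ∀ x, R (P x) = P (R x) := fun x =>
    congrArg (fun S : X →L[𝕜] X => S x) (hcomm P hPL).1.eq.symm
  have hQR : ∀ x, R (Q x) = Q (R x) := fun x =>
    congrArg (fun S : X →L[𝕜] X => S x) (hcomm Q hQL).1.eq.symm
  let V := LinearMap.range (R : X →ₗ[𝕜] X)
  let r : X →L[𝕜] V := R.codRestrict V fun x => LinearMap.mem_range_self (R : X →ₗ[𝕜] X) x
  have hr : ∀ x : V, r x = x := by
    rintro ⟨_, x, rfl⟩
    exact Subtype.ext (congrArg (fun S : X →L[𝕜] X => S x) hR)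
  have hPV : ∀ x ∈ V, (P : X →ₗ[𝕜] X) x ∈ V := by
    rintro _ ⟨x, rfl⟩
    exact ⟨P x, hPR x⟩
  have hQV : ∀ x ∈ V, (Q : X →ₗ[𝕜] X) x ∈ V := by
    rintro _ ⟨x, rfl⟩
    exact ⟨Q x, hQR x⟩
  -- `P - Q` acts as `1` on the joint eigenvectors, so `L` kills them.
  have hEV : jointEigenspace P Q (1 : 𝕜) 0 ≤ V := fun x hx => by
    obtain ⟨h1, h2⟩ : P x = (1 : 𝕜) • x ∧ Q x = (0 : 𝕜) • x := hx
    have h3 : (P - Q) x = x := by simp [h1, h2]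
    have h4 : ∀ k : ℕ, ((P - Q) ^ k) x = x := fun k => by
      induction k with
      | zero => rfl
      | succ k ih => rw [pow_succ, mul_apply_eq_comp, h3, ih]
    have h5 : L x = 0 := by
      rw [hL, sub_apply, h4, one_apply_eq_self, sub_self]
    have h6 : x - R x = D (L x) := congrArg (fun S : X →L[𝕜] X => S x) hD.symm
    rw [h5, map_zero, sub_eq_zero] at h6
    exact ⟨x, h6.symm⟩
  -- Dually, `P - Q` acts as `-1`, so functionals in the dual joint eigenspace vanish on `range L`.
  have hφ : ∀ φ ∈ jointEigenspace (dualOp P) (dualOp Q) (0 : 𝕜) 1, ∀ x, φ (r x) = φ x := by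
    intro φ hφ x
    obtain ⟨h1, h2⟩ := mem_jointEigenspace_dualOp.1 hφ
    have h3 : ∀ y, φ ((P - Q) y) = -φ y := fun y => by
      rw [sub_apply, map_sub, h1, h2, zero_mul, one_mul, zero_sub]
    have h4 : ∀ (k : ℕ) y, φ (((P - Q) ^ (2 * k)) y) = φ y := fun k => by
      induction k with
      | zero => exact fun y => rfl
      | succ k ih =>
        intro y
        rw [mul_add, mul_one, pow_add, mul_apply_eq_comp, ih, sq, mul_apply_eq_comp, h3, h3,
          neg_neg]
    have h5 : x - R x = L (D x) := congrArg (fun S : X →L[𝕜] X => S x) hLD.symm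
    have h6 : φ (x - R x) = 0 := by
      rw [h5, hL, sub_apply, map_sub, h4, one_apply_eq_self, sub_self]
    rw [map_sub, sub_eq_zero] at h6
    exact h6.symm
  have hE := jointEigenspace_one_zero_eq_map hP hPV hQV hEV
  obtain ⟨e⟩ := nonempty_dual_jointEigenspace_equiv hQ hPV hQV r hr hPR hQR hφ
  refine ⟨Submodule.finiteDimensional_of_le hEV, Module.Finite.equiv e.symm, ?_⟩
  have hp : IsIdempotentElem ((P : X →ₗ[𝕜] X).restrict hPV) :=
    LinearMap.ext fun x => Subtype.ext (congrArg (fun S : X →L[𝕜] X => S x) hP)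
  have hq : IsIdempotentElem ((Q : X →ₗ[𝕜] X).restrict hQV) :=
    LinearMap.ext fun x => Subtype.ext (congrArg (fun S : X →L[𝕜] X => S x) hQ)
  have htr := trace_sub_eq_finrank_sub_finrank hp hq
  rw [← trace_sub_pow_of_odd hp hq hn, ← e.finrank_eq, ← Submodule.finrank_map_subtype_eq, ← hE]
    at htr
  have h1 := hasTraceRep_comp r (((P - Q) ^ n).comp V.subtypeL)
  have h2 : (((P - Q) ^ n).comp V.subtypeL) ∘L r = (P - Q) ^ n * R := rfl
  have hpow : ∀ (k : ℕ) (x : V), ((((P : X →ₗ[𝕜] X).restrict hPV -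
      (Q : X →ₗ[𝕜] X).restrict hQV) ^ k) x : X) = ((P - Q) ^ k) x := fun k => by
    induction k with
    | zero => exact fun x => rfl
    | succ k ih =>
      intro x
      rw [pow_succ, pow_succ, Module.End.mul_apply, ih, mul_apply_eq_comp]
      rfl
  have h3 : ((r ∘L (((P - Q) ^ n).comp V.subtypeL) : V →L[𝕜] V) : V →ₗ[𝕜] V) =
      ((P : X →ₗ[𝕜] X).restrict hPV - (Q : X →ₗ[𝕜] X).restrict hQV) ^ n :=
    LinearMap.ext fun x => by
      change r (((P - Q) ^ n) x) = _
      rw [← hpow n x, hr]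
  rw [h2, h3, htr] at h1
  have h4 := h1.add (hasTraceRep_sub_pow_mul_compl hX hP hQ hn hT hD hcomm)
  rwa [← mul_add, add_sub_cancel, mul_one, add_zero] at h4

end Banach

/-! ### Joint eigenspaces of self-adjoint projections -/

/-- For self-adjoint operators the Riesz isomorphism, which is conjugate-linear, identifies the
joint eigenspaces with those of the dual operators (for eigenvalues fixed by conjugation). -/
theorem finrank_dual_jointEigenspace_of_isSelfAdjoint {𝕜 H : Type*} [RCLike 𝕜]
    [NormedAddCommGroup H] [InnerProductSpace 𝕜 H] [CompleteSpace H] {P Q : H →L[𝕜] H}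
    (hP : IsSelfAdjoint P) (hQ : IsSelfAdjoint Q) {a b : 𝕜} (ha : star a = a) (hb : star b = b) :
    Module.finrank 𝕜 (jointEigenspace (dualOp P) (dualOp Q) a b) =
      Module.finrank 𝕜 (jointEigenspace P Q a b) := by
  have hdual : ∀ {S : H →L[𝕜] H}, IsSelfAdjoint S → ∀ {c : 𝕜}, star c = c → ∀ x,
      dualOp S (InnerProductSpace.toDual 𝕜 H x) = c • InnerProductSpace.toDual 𝕜 H x ↔
        S x = c • x := by
    intro S hS c hc x
    have h1 : dualOp S (InnerProductSpace.toDual 𝕜 H x) = InnerProductSpace.toDual 𝕜 H (S x) := by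
      ext y
      rw [dualOp_apply, InnerProductSpace.toDual_apply_apply, InnerProductSpace.toDual_apply_apply,
        ← ContinuousLinearMap.adjoint_inner_left, hS.adjoint_eq]
    have h2 : c • InnerProductSpace.toDual 𝕜 H x = InnerProductSpace.toDual 𝕜 H (c • x) := by
      rw [map_smulₛₗ, starRingEnd_apply, hc]
    rw [h1, h2, (InnerProductSpace.toDual 𝕜 H).injective.eq_iff]
  have hmem : ∀ x, InnerProductSpace.toDual 𝕜 H x ∈ jointEigenspace (dualOp P) (dualOp Q) a b ↔
      x ∈ jointEigenspace P Q a b := fun x => and_congr (hdual hP ha x) (hdual hQ hb x)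
  let j : jointEigenspace P Q a b →+ jointEigenspace (dualOp P) (dualOp Q) a b :=
    { toFun := fun x => ⟨InnerProductSpace.toDual 𝕜 H x, (hmem x).2 x.2⟩
      map_zero' := Subtype.ext (map_zero _)
      map_add' := fun x y => Subtype.ext (map_add _ _ _) }
  have hj : Function.Bijective j := by
    refine ⟨fun x y h => Subtype.ext ?_, fun ⟨φ, hφ⟩ => ?_⟩
    · have h' : (j x : StrongDual 𝕜 H) = j y := by rw [h]
      exact (InnerProductSpace.toDual 𝕜 H).injective h'
    · obtain ⟨x, rfl⟩ := (InnerProductSpace.toDual 𝕜 H).surjective φ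
      exact ⟨⟨x, (hmem x).1 hφ⟩, rfl⟩
  have h := lift_rank_eq_of_equiv_equiv (starRingEnd 𝕜) (AddEquiv.ofBijective j hj)
    (star_involutive (R := 𝕜)).bijective fun c x =>
      Subtype.ext (map_smulₛₗ (InnerProductSpace.toDual 𝕜 H) c (x : H))
  have h' := congrArg Cardinal.toNat h
  rw [Cardinal.toNat_lift, Cardinal.toNat_lift] at h'
  exact h'.symm

end ProjectionTrace

end

theorem mainTheorem1 {𝕜 : Type*} [RCLike 𝕜] :
    -- Banach spaces with the approximation property
    (∀ (X : Type*) [NormedAddCommGroup X] [NormedSpace 𝕜 X] [CompleteSpace X],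
      ProjectionTrace.ApproximationProperty 𝕜 X →
      ∀ (P Q : X →L[𝕜] X), IsIdempotentElem P → IsIdempotentElem Q →
      ∀ n : ℕ, Odd n → ProjectionTrace.IsNuclear ((P - Q) ^ n) →
        let E (a b : 𝕜) : Submodule 𝕜 X := ProjectionTrace.jointEigenspace P Q a b
        let E' (a b : 𝕜) : Submodule 𝕜 (StrongDual 𝕜 X) :=
          ProjectionTrace.jointEigenspace
            (ProjectionTrace.dualOp P) (ProjectionTrace.dualOp Q) a b
        FiniteDimensional 𝕜 (E 1 0) ∧ FiniteDimensional 𝕜 (E 0 1) ∧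
        FiniteDimensional 𝕜 (E' 1 0) ∧ FiniteDimensional 𝕜 (E' 0 1) ∧
        ∃ d : ℤ, ProjectionTrace.HasNuclearTrace ((P - Q) ^ n) (d : 𝕜) ∧
          d = (Module.finrank 𝕜 (E 1 0) : ℤ) - (Module.finrank 𝕜 (E' 0 1) : ℤ) ∧
          d = (Module.finrank 𝕜 (E' 1 0) : ℤ) - (Module.finrank 𝕜 (E 0 1) : ℤ)) ∧
    -- Hilbert spaces and self-adjoint projections
    (∀ (H : Type*) [NormedAddCommGroup H] [InnerProductSpace 𝕜 H] [CompleteSpace H]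
      (P Q : H →L[𝕜] H), IsIdempotentElem P → IsIdempotentElem Q →
      IsSelfAdjoint P → IsSelfAdjoint Q →
      ∀ n : ℕ, Odd n → ProjectionTrace.IsNuclear ((P - Q) ^ n) →
        let E (a b : 𝕜) : Submodule 𝕜 H := ProjectionTrace.jointEigenspace P Q a b
        FiniteDimensional 𝕜 (E 1 0) ∧ FiniteDimensional 𝕜 (E 0 1) ∧
        ProjectionTrace.HasNuclearTrace ((P - Q) ^ n)
          (((Module.finrank 𝕜 (E 1 0) : ℤ) - (Module.finrank 𝕜 (E 0 1) : ℤ) : ℤ) : 𝕜)) := by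
  refine ⟨?_, ?_⟩
  · intro X _ _ _ hX P Q hP hQ n hn hT E E'
    obtain ⟨h10, h01', htr⟩ := ProjectionTrace.hasTraceRep_sub_pow hX hP hQ hn hT
    have hneg : (Q - P) ^ n = -(P - Q) ^ n := by rw [← neg_sub P Q, hn.neg_pow]
    have hT' : ProjectionTrace.IsNuclear ((Q - P) ^ n) := by
      rw [hneg, ← neg_one_mul]
      exact hT.mul_left _
    obtain ⟨h01, h10', htr'⟩ := ProjectionTrace.hasTraceRep_sub_pow hX hQ hP hn hT'
    rw [ProjectionTrace.jointEigenspace_swap] at h01 h10' htr'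
    rw [ProjectionTrace.jointEigenspace_swap (ProjectionTrace.dualOp Q)] at htr'
    refine ⟨h10, h01, h10', h01', _, htr.hasNuclearTrace hX, rfl, ?_⟩
    have h := htr'.neg
    rw [hneg, neg_neg, ← Int.cast_neg, neg_sub] at h
    exact Int.cast_injective (htr.unique hX h)
  · intro H _ _ _ P Q hP hQ hPs hQs n hn hT E
    have hH := ProjectionTrace.approximationProperty_of_innerProductSpace (𝕜 := 𝕜) (H := H)
    obtain ⟨h10, -, htr⟩ := ProjectionTrace.hasTraceRep_sub_pow hH hP hQ hn hT
    have hneg : (Q - P) ^ n = -(P - Q) ^ n := by rw [← neg_sub P Q, hn.neg_pow]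
    have hT' : ProjectionTrace.IsNuclear ((Q - P) ^ n) := by
      rw [hneg, ← neg_one_mul]
      exact hT.mul_left _
    obtain ⟨h01, -, -⟩ := ProjectionTrace.hasTraceRep_sub_pow hH hQ hP hn hT'
    rw [ProjectionTrace.jointEigenspace_swap] at h01
    refine ⟨h10, h01, ?_⟩
    rw [ProjectionTrace.finrank_dual_jointEigenspace_of_isSelfAdjoint hPs hQs (star_zero _)
      (star_one _)] at htr
    exact htr.hasNuclearTrace hH
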